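/- For $n\ge 1$ let $S_n$ be the symmetric group on $\{1,\dots,n\}$ with the normalized Hamming metric $d(\sigma,\tau)=\frac1n|\{i:\sigma(i)\ne\tau(i)\}|$. For probability measures $\mu,\nu$ on $S_n$ let $$d(\mu,\nu)=\min_{\gamma}\int d(\sigma,\tau)\,d\gamma(\sigma,\tau)$$ be their Kantorovich–Rubinstein distance, where $\gamma$ ranges over the probability measures on $S_n\times S_n$ with first marginal $\mu$ and second marginal $\nu$. For a word $w$ in the free group $\mathbb F_r$ on $x_1,\dots,x_r$, let $\mu_w^{S_n}$ be the push-forward of the uniform probability measure on $S_n^r$ under the word map $(\sigma_1,\dots,\sigma_r)\mapsto w(\sigma_1,\dots,\sigma_r)$, and let $\mu_{\rm unif}^{S_n}$ be the uniform probability measure on $S_n$. Let $\varepsilon>0$. There exists a constant $c_\varepsilon>0$, depending only on $\varepsilon$, such that for every $r$, every non-trivial word $w\in\mathbb F_r$, with (reduced) length $l$, and every $n\ge 1$, $$d(\mu_w^{S_n},\mu_{\rm unif}^{S_n})\le c_\varepsilon\, l^2\, n^{-1/3+\varepsilon}.$$ -/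

import Mathlib

/-- The normalized Hamming metric on `S_n`:
`d(σ, τ) = (1/n) * #{i | σ i ≠ τ i}`. -/
noncomputable def normHamming {n : ℕ} (σ τ : Equiv.Perm (Fin n)) : ℝ :=
  (hammingDist (⇑σ) (⇑τ) : ℝ) / (n : ℝ)

/-- The word map `G^r → G` of a word `w ∈ F_r`: evaluation of `w` at an `r`-tuple, i.e. the image
of `w` under the unique homomorphism `F_r → G` with `x_i ↦ g i`. -/
def wordMap {r : ℕ} (w : FreeGroup (Fin r)) (G : Type*) [Group G] (g : Fin r → G) : G :=
  FreeGroup.lift g w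

/-- The distribution of word values of `w` on a finite group `G`: the push-forward along the word
map of the uniform probability measure on `G^r`. -/
noncomputable def wordDistribution {r : ℕ} (w : FreeGroup (Fin r))
    (G : Type*) [Group G] [Fintype G] : PMF G :=
  (PMF.uniformOfFintype (Fin r → G)).map (wordMap w G)

/-- `γ` is a coupling (transport plan) of `μ` and `ν`: its two marginals are `μ` and `ν`. -/
def IsCoupling {X : Type*} (μ ν : PMF X) (γ : PMF (X × X)) : Prop :=
  γ.map Prod.fst = μ ∧ γ.map Prod.snd = ν

/-- The expected cost `∫ d(x, y) dγ(x, y)` of a transport plan on a finite set. -/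
noncomputable def transportCost {X : Type*} [Fintype X] (d : X → X → ℝ) (γ : PMF (X × X)) : ℝ :=
  ∑ p : X × X, (γ p).toReal * d p.1 p.2

/-- The Kantorovich–Rubinstein distance of two probability measures on a finite set with respect to
a distance function `d`: the least expected cost of a coupling. The set of couplings is non-empty
(it contains the product measure) and compact, so the infimum is a minimum. -/
noncomputable def krDist {X : Type*} [Fintype X] (d : X → X → ℝ) (μ ν : PMF X) : ℝ :=
  sInf {c : ℝ | ∃ γ : PMF (X × X), IsCoupling μ ν γ ∧ c = transportCost d γ}

/-! Both distributions are conjugation invariant, and a permutation with few orbits can be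
conjugated close to the long cycle. Draw `σ` and `τ` independently, conjugate each close to the long
cycle, then conjugate both by one uniform `ρ`: this is a coupling, of cost at most (orbits of `σ` +
orbits of `τ` + 2)/n (`krDist_le_orbitCount`). It remains to bound expected orbit counts.

Orbits longer than `M` number at most n/M, and shorter ones are detected by fixed points of `σ ^ j`,
`j ≤ M` (`orbitCount_le`). If `σ` is a value of `w`, then `σ ^ j` is a value of the non-trivial word
`w ^ j`, of length at most jl. A non-trivial word of length at most m ≤ n/2 has on average at most
2m² fixed points: the walk of a fixed point along the word repeats a vertex, and a switching
argument makes each possible first return rare (`card_return_mul_le`). The expected orbit count is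
thus at most n/M + 2l²M², and M ≈ n^(1/3) gives 20 l² n^(-1/3), with no loss of ε. -/

/-! ### Fixed points of random word values -/

section Walk

variable {α X : Type*}

/-- The permutation attached to a letter `x_i` or `x_i⁻¹`. -/
def letterPerm (g : α → Equiv.Perm X) (b : α × Bool) : Equiv.Perm X :=
  cond b.2 (g b.1) (g b.1)⁻¹

/-- The end point of the walk that starts at `x` and applies the letters of a word, the last letter
first. -/
def walkEnd (g : α → Equiv.Perm X) (x : X) : List (α × Bool) → X
  | [] => x
  | b :: L => letterPerm g b (walkEnd g x L)

/-- The points visited by the walk, the end point first. -/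
def walkPath (g : α → Equiv.Perm X) (x : X) : List (α × Bool) → List X
  | [] => [x]
  | b :: L => letterPerm g b (walkEnd g x L) :: walkPath g x L

theorem length_walkPath (g : α → Equiv.Perm X) (x : X) (L : List (α × Bool)) :
    (walkPath g x L).length = L.length + 1 := by
  induction L with
  | nil => rfl
  | cons b L ih => simp [walkPath, ih]

theorem walkEnd_mem_walkPath (g : α → Equiv.Perm X) (x : X) (L : List (α × Bool)) :
    walkEnd g x L ∈ walkPath g x L := by
  cases L <;> simp [walkEnd, walkPath]

theorem start_mem_walkPath (g : α → Equiv.Perm X) (x : X) (L : List (α × Bool)) :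
    x ∈ walkPath g x L := by
  induction L with
  | nil => simp [walkPath]
  | cons b L ih => simp [walkPath, ih]

theorem walkEnd_eq_lift (g : α → Equiv.Perm X) (x : X) (L : List (α × Bool)) :
    walkEnd g x L = FreeGroup.lift g (FreeGroup.mk L) x := by
  rw [FreeGroup.lift_mk]
  induction L with
  | nil => rfl
  | cons b L ih =>
    rw [List.map_cons, List.prod_cons, Equiv.Perm.mul_apply, ← ih]
    rfl

theorem walkEnd_ne_of_nodup {g : α → Equiv.Perm X} {x : X} {L : List (α × Bool)}
    (hL : L ≠ []) (h : (walkPath g x L).Nodup) : walkEnd g x L ≠ x := by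
  obtain ⟨b, L, rfl⟩ := List.exists_cons_of_ne_nil hL
  intro hx
  exact (List.nodup_cons.1 h).1 (by
    change walkEnd g x (b :: L) ∈ _
    rw [hx]
    exact start_mem_walkPath g x L)

theorem mem_walkPath_of_suffix (g : α → Equiv.Perm X) (x : X) {L K : List (α × Bool)}
    (h : K <:+ L) : walkEnd g x K ∈ walkPath g x L := by
  induction L with
  | nil => rw [List.suffix_nil.1 h]; exact walkEnd_mem_walkPath g x []
  | cons b L ih =>
    rcases List.suffix_cons_iff.1 h with rfl | h
    · exact walkEnd_mem_walkPath g x _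
    · exact List.mem_cons_of_mem _ (ih h)

/-- Along a walk without repetitions, different suffixes of the word end at different points. -/
theorem suffix_eq_of_walkEnd_eq {g : α → Equiv.Perm X} {x : X} {L K : List (α × Bool)}
    (hnd : (walkPath g x L).Nodup) (h : K <:+ L) (he : walkEnd g x K = walkEnd g x L) :
    K = L := by
  cases L with
  | nil => exact List.suffix_nil.1 h
  | cons b L =>
    rcases List.suffix_cons_iff.1 h with rfl | h
    · rfl
    · refine absurd ?_ (List.nodup_cons.1 hnd).1
      change walkEnd g x (b :: L) ∈ _
      rw [← he]
      exact mem_walkPath_of_suffix g x h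

theorem walkEnd_congr {g g' : α → Equiv.Perm X} {x : X} {L : List (α × Bool)}
    (h : ∀ b K, b :: K <:+ L → letterPerm g' b (walkEnd g x K) = letterPerm g b (walkEnd g x K)) :
    walkEnd g' x L = walkEnd g x L := by
  induction L with
  | nil => rfl
  | cons b L ih =>
    have := ih fun c K hK => h c K (hK.trans (List.suffix_cons b L))
    simp only [walkEnd, this]
    exact h b L List.suffix_rfl

theorem walkPath_congr {g g' : α → Equiv.Perm X} {x : X} {L : List (α × Bool)}
    (h : ∀ b K, b :: K <:+ L → letterPerm g' b (walkEnd g x K) = letterPerm g b (walkEnd g x K)) :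
    walkPath g' x L = walkPath g x L := by
  induction L with
  | nil => rfl
  | cons b L ih =>
    have h' : ∀ c K, c :: K <:+ L →
      letterPerm g' c (walkEnd g x K) = letterPerm g c (walkEnd g x K) :=
        fun c K hK => h c K (hK.trans (List.suffix_cons b L))
    simp only [walkPath, ih h', walkEnd_congr h']
    rw [h b L List.suffix_rfl]

theorem letterPerm_not (g : α → Equiv.Perm X) (i : α) (c : Bool) :
    letterPerm g (i, !c) = (letterPerm g (i, c))⁻¹ := by
  cases c <;> simp [letterPerm]

variable [DecidableEq α] [DecidableEq X]

/-- Change the tuple `g` so that the letter `a` is followed by the transposition of `z` and `y`. -/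
def redirect (a : α × Bool) (z y : X) (g : α → Equiv.Perm X) : α → Equiv.Perm X :=
  Function.update g a.1
    (cond a.2 (Equiv.swap z y * g a.1) (g a.1 * Equiv.swap z y))

theorem redirect_redirect (a : α × Bool) (z y : X) (g : α → Equiv.Perm X) :
    redirect a z y (redirect a z y g) = g := by
  obtain ⟨i, b⟩ := a
  cases b <;> ext j : 1 <;> by_cases hj : j = i
  all_goals first | subst hj | skip
  all_goals simp [redirect, *, ← mul_assoc]

theorem letterPerm_redirect_self (a : α × Bool) (z y : X) (g : α → Equiv.Perm X) :
    letterPerm (redirect a z y g) a = Equiv.swap z y * letterPerm g a := by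
  obtain ⟨i, b⟩ := a
  cases b <;> simp [redirect, letterPerm]

theorem letterPerm_redirect_of_ne {a b : α × Bool} (h : b.1 ≠ a.1) (z y : X)
    (g : α → Equiv.Perm X) : letterPerm (redirect a z y g) b = letterPerm g b := by
  simp [redirect, letterPerm, h]

/-- The swap matters only at `z` and `y`, and the walk avoids `y`. An earlier step by `a` arriving
at `z` would start at the current end point, contrary to `Nodup`. A step by the inverse of `a`
leaving `z` would reach the current end point, so it would be the last step so far, contrary to
reducedness. -/
theorem walkPath_redirect {a : α × Bool} {L : List (α × Bool)} {g : α → Equiv.Perm X} {x y : X}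
    (hred : FreeGroup.IsReduced (a :: L)) (hnd : (walkPath g x L).Nodup)
    (hy : y ∉ walkPath g x L) :
    walkPath (redirect a (letterPerm g a (walkEnd g x L)) y g) x L = walkPath g x L ∧
    walkEnd (redirect a (letterPerm g a (walkEnd g x L)) y g) x L = walkEnd g x L := by
  set z := letterPerm g a (walkEnd g x L) with hz
  have key : ∀ b K, b :: K <:+ L → letterPerm (redirect a z y g) b (walkEnd g x K) =
      letterPerm g b (walkEnd g x K) := by
    intro b K hK
    have hKL : K <:+ L := (List.suffix_cons b K).trans hK
    have hne : K ≠ L := by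
      rintro rfl
      simpa using hK.length_le
    have h1 : letterPerm g b (walkEnd g x K) ≠ y := by
      rintro rfl
      exact hy (mem_walkPath_of_suffix g x hK)
    have h2 : walkEnd g x K ≠ y := by
      rintro rfl
      exact hy (mem_walkPath_of_suffix g x hKL)
    by_cases hba : b.1 = a.1
    · by_cases hb2 : b.2 = a.2
      · obtain rfl : b = a := Prod.ext hba hb2
        rw [letterPerm_redirect_self, Equiv.Perm.mul_apply]
        refine Equiv.swap_apply_of_ne_of_ne (fun h => hne ?_) h1
        exact suffix_eq_of_walkEnd_eq hnd hKL ((letterPerm g b).injective h)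
      · obtain rfl : b = (a.1, !a.2) := Prod.ext hba (by
          cases h : a.2 <;> cases h' : b.2 <;> simp_all)
        rw [letterPerm_not, letterPerm_not, letterPerm_redirect_self, mul_inv_rev,
          Equiv.Perm.mul_apply, Equiv.swap_inv]
        rw [Equiv.swap_apply_of_ne_of_ne _ h2]
        intro h
        have he : (a.1, !a.2) :: K = L := by
          refine suffix_eq_of_walkEnd_eq hnd hK ?_
          rw [walkEnd, letterPerm_not, h, hz]
          simp
        rw [← he] at hred
        have := (FreeGroup.isReduced_cons_cons.1 hred).1 rfl
        simp at this
    · rw [letterPerm_redirect_of_ne hba]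
  exact ⟨walkPath_congr key, walkEnd_congr key⟩

variable [Fintype α] [Fintype X]

/-- The tuples for which the next step of the walk returns to its `i`-th point are rare. -/
theorem card_return_mul_le {a : α × Bool} {L : List (α × Bool)}
    (hred : FreeGroup.IsReduced (a :: L)) (x : X) (i : ℕ) :
    (Finset.univ.filter fun g : α → Equiv.Perm X =>
      (walkPath g x L).Nodup ∧ (walkPath g x L)[i]? = some (walkEnd g x (a :: L))).card *
      (Fintype.card X - (L.length + 1)) ≤ Fintype.card (α → Equiv.Perm X) := by
  set A := Finset.univ.filter fun g : α → Equiv.Perm X =>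
      (walkPath g x L).Nodup ∧ (walkPath g x L)[i]? = some (walkEnd g x (a :: L)) with hA
  have hcard : A.card * (Fintype.card X - (L.length + 1)) ≤
      (A.sigma fun g => (walkPath g x L).toFinsetᶜ).card := by
    rw [Finset.card_sigma, ← smul_eq_mul]
    refine Finset.card_nsmul_le_sum _ _ _ fun g hg => ?_
    have hg := (Finset.mem_filter.1 hg).2
    rw [Finset.card_compl, List.toFinset_card_of_nodup hg.1, length_walkPath]
  refine hcard.trans ?_
  rw [← Finset.card_univ]
  -- Switching: send the returning step to an unvisited `y` instead. The new tuple determines `y` as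
  -- its new end point; the path is unchanged, so its `i`-th point recovers `z`, and redirecting
  -- again recovers `g`.
  refine Finset.card_le_card_of_injOn
    (fun p => redirect a (walkEnd p.1 x (a :: L)) p.2 p.1) (fun _ _ => Finset.mem_coe.2 (Finset.mem_univ _)) ?_
  rintro ⟨g, y⟩ hp ⟨g', y'⟩ hp' heq
  simp only [Finset.coe_sigma, Set.mem_sigma_iff, Finset.mem_coe, Finset.mem_compl,
    List.mem_toFinset, hA, Finset.mem_filter, Finset.mem_univ, true_and] at hp hp' heq
  obtain ⟨⟨hnd, hi⟩, hy⟩ := hp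
  obtain ⟨⟨hnd', hi'⟩, hy'⟩ := hp'
  obtain ⟨h1, h2⟩ := walkPath_redirect hred hnd hy
  obtain ⟨h1', h2'⟩ := walkPath_redirect hred hnd' hy'
  simp only [walkEnd] at heq hi hi'
  have hend : walkEnd (redirect a (letterPerm g a (walkEnd g x L)) y g) x (a :: L) = y := by
    rw [walkEnd, h2, letterPerm_redirect_self]; simp
  have hend' : walkEnd (redirect a (letterPerm g' a (walkEnd g' x L)) y' g') x (a :: L) = y' := by
    rw [walkEnd, h2', letterPerm_redirect_self]; simp
  have hyy : y = y' := by rw [← hend, heq, hend']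
  have hpath : walkPath g x L = walkPath g' x L := by rw [← h1, heq, h1']
  have hz : letterPerm g a (walkEnd g x L) = letterPerm g' a (walkEnd g' x L) := by
    rw [hpath, hi'] at hi
    exact (Option.some.inj hi).symm
  subst hyy
  rw [hz] at heq
  have := congrArg (redirect a (letterPerm g' a (walkEnd g' x L)) y) heq
  rw [redirect_redirect, redirect_redirect] at this
  rw [this]

/-- Union bound over the step of the first repetition and the index of the point it returns to.
Keeping `m` fixed gives every step of the induction the same factor. -/
theorem card_not_nodup_mul_le {L : List (α × Bool)} (hred : FreeGroup.IsReduced L) (x : X)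
    {m : ℕ} (hm : L.length ≤ m) :
    (Finset.univ.filter fun g : α → Equiv.Perm X => ¬ (walkPath g x L).Nodup).card *
      (Fintype.card X - m) ≤ L.length * m * Fintype.card (α → Equiv.Perm X) := by
  induction L with
  | nil => simp [walkPath]
  | cons a L ih =>
    have hlen : L.length + 1 ≤ m := by simpa using hm
    have ih := ih (hred.infix (List.suffix_cons a L).isInfix) (by omega)
    let A : ℕ → Finset (α → Equiv.Perm X) := fun i => Finset.univ.filter fun g =>
      (walkPath g x L).Nodup ∧ (walkPath g x L)[i]? = some (walkEnd g x (a :: L))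
    have hsub : (Finset.univ.filter fun g : α → Equiv.Perm X => ¬ (walkPath g x (a :: L)).Nodup) ⊆
        (Finset.univ.filter fun g : α → Equiv.Perm X => ¬ (walkPath g x L).Nodup) ∪
          (Finset.range (L.length + 1)).biUnion A := by
      intro g hg
      rw [Finset.mem_filter] at hg
      by_cases hnd : (walkPath g x L).Nodup
      · have hmem : walkEnd g x (a :: L) ∈ walkPath g x L := by
          by_contra h
          exact hg.2 (List.nodup_cons.2 ⟨h, hnd⟩)
        obtain ⟨i, hi, he⟩ := List.getElem_of_mem hmem
        rw [Finset.mem_union, Finset.mem_biUnion]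
        refine Or.inr ⟨i, ?_, ?_⟩
        · rw [length_walkPath] at hi
          exact Finset.mem_range.2 hi
        · simp only [A, Finset.mem_filter, Finset.mem_univ, true_and]
          exact ⟨hnd, by rw [List.getElem?_eq_getElem hi, he]⟩
      · exact Finset.mem_union_left _ (by simpa using hnd)
    have hA : ∀ i, (A i).card * (Fintype.card X - m) ≤ Fintype.card (α → Equiv.Perm X) :=
      fun i => (Nat.mul_le_mul_left _ (by omega)).trans (card_return_mul_le hred x i)
    calc _ ≤ ((Finset.univ.filter fun g : α → Equiv.Perm X => ¬ (walkPath g x L).Nodup).card +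
          ∑ i ∈ Finset.range (L.length + 1), (A i).card) * (Fintype.card X - m) := by
            gcongr
            exact (Finset.card_le_card hsub).trans ((Finset.card_union_le _ _).trans
              (Nat.add_le_add_left Finset.card_biUnion_le _))
      _ ≤ L.length * m * Fintype.card (α → Equiv.Perm X) +
          ∑ i ∈ Finset.range (L.length + 1), Fintype.card (α → Equiv.Perm X) := by
            rw [add_mul, Finset.sum_mul]
            exact Nat.add_le_add ih (Finset.sum_le_sum fun i _ => hA i)
      _ ≤ L.length * m * Fintype.card (α → Equiv.Perm X) +
          m * Fintype.card (α → Equiv.Perm X) := by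
            rw [Finset.sum_const, Finset.card_range, smul_eq_mul]
            gcongr
      _ = _ := by rw [List.length_cons]; ring

/-- The number of tuples for which a non-trivial word of length at most `m` fixes a given point. -/
theorem card_fixing_mul_le {w : FreeGroup α} (hw : w ≠ 1) (x : X) {m : ℕ} (hm : w.norm ≤ m) :
    (Finset.univ.filter fun g : α → Equiv.Perm X => FreeGroup.lift g w x = x).card *
      (Fintype.card X - m) ≤ m * m * Fintype.card (α → Equiv.Perm X) := by
  have hne : w.toWord ≠ [] := fun h => hw (FreeGroup.toWord_eq_nil_iff.1 h)
  calc _ ≤ (Finset.univ.filter fun g : α → Equiv.Perm X =>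
        ¬ (walkPath g x w.toWord).Nodup).card * (Fintype.card X - m) := by
          gcongr with g
          intro h hnd
          refine walkEnd_ne_of_nodup hne hnd ?_
          rw [walkEnd_eq_lift, FreeGroup.mk_toWord, h]
    _ ≤ _ := card_not_nodup_mul_le FreeGroup.isReduced_toWord x hm
    _ ≤ _ := by
      gcongr
      exact hm

end Walk

/-! ### Permutations with few cycles are close to a conjugate of the long cycle -/

section Cycles

open Function

theorem iterate_eq_pow_apply {X : Type*} (σ : Equiv.Perm X) (i : ℕ) (x : X) : σ^[i] x = (σ ^ i) x := by
  rw [Equiv.Perm.iterate_eq_pow]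

variable {X : Type*} [Fintype X]

theorem minimalPeriod_perm_pos (σ : Equiv.Perm X) (x : X) : 0 < minimalPeriod σ x := by
  refine minimalPeriod_pos_of_mem_periodicPts ?_
  exact ⟨orderOf σ, orderOf_pos σ, by
    rw [IsPeriodicPt, IsFixedPt, iterate_eq_pow_apply, pow_orderOf_eq_one]; rfl⟩

theorem sameCycle_iff_exists_iterate {σ : Equiv.Perm X} {x y : X} :
    σ.SameCycle x y ↔ ∃ i < minimalPeriod σ x, σ^[i] x = y := by
  constructor
  · intro h
    obtain ⟨i, -, hi⟩ := h.exists_pow_eq'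
    exact ⟨i % minimalPeriod σ x, Nat.mod_lt _ (minimalPeriod_perm_pos σ x), by
      rw [iterate_mod_minimalPeriod_eq, iterate_eq_pow_apply, hi]⟩
  · rintro ⟨i, -, rfl⟩
    rw [iterate_eq_pow_apply]
    exact ⟨i, by simp⟩

/-- The number of orbits of a permutation, fixed points included. -/
noncomputable def orbitCount (σ : Equiv.Perm X) : ℕ :=
  Nat.card (Quotient (Equiv.Perm.SameCycle.setoid σ))

-- The points of an orbit of length k carry weight 1/k each, so every orbit has total weight 1.
open Classical in
theorem orbitCount_le_sum (σ : Equiv.Perm X) :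
    (orbitCount σ : ℝ) ≤ ∑ x, (1 : ℝ) / minimalPeriod σ x := by
  let _ : Setoid X := Equiv.Perm.SameCycle.setoid σ
  have hfib : ∀ q : Quotient (Equiv.Perm.SameCycle.setoid σ), (1 : ℝ) ≤
      ∑ x ∈ Finset.univ.filter (fun x => (⟦x⟧ : Quotient (Equiv.Perm.SameCycle.setoid σ)) = q),
        (1 : ℝ) / minimalPeriod σ x := by
    intro q
    induction q using Quotient.inductionOn with | _ y => ?_
    have hpos := minimalPeriod_perm_pos σ y
    have hinj : Set.InjOn (fun i => σ^[i] y) (Finset.range (minimalPeriod σ y)) := by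
      intro i hi j hj h
      exact (iterate_eq_iterate_iff_of_lt_minimalPeriod (by simpa using hi) (by simpa using hj)).1 h
    calc (1 : ℝ) = ∑ i ∈ Finset.range (minimalPeriod σ y),
          (1 : ℝ) / minimalPeriod σ (σ^[i] y) := by
            have : ∀ i, minimalPeriod σ (σ^[i] y) = minimalPeriod σ y := fun i =>
              minimalPeriod_apply_iterate (minimalPeriod_pos_iff_mem_periodicPts.1 hpos) i
            simp only [this, Finset.sum_const, Finset.card_range, nsmul_eq_mul]
            field_simp
      _ = ∑ x ∈ (Finset.range (minimalPeriod σ y)).image (fun i => σ^[i] y),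
          (1 : ℝ) / minimalPeriod σ x := by rw [Finset.sum_image hinj]
      _ ≤ _ := by
        refine Finset.sum_le_sum_of_subset_of_nonneg ?_ fun _ _ _ => by positivity
        intro x hx
        obtain ⟨i, hi, rfl⟩ := Finset.mem_image.1 hx
        refine Finset.mem_filter.2 ⟨Finset.mem_univ _, Quotient.sound ?_⟩
        exact (sameCycle_iff_exists_iterate.2 ⟨i, Finset.mem_range.1 hi, rfl⟩).symm
  rw [orbitCount, Nat.card_eq_fintype_card, ← Finset.card_univ, Finset.card_eq_sum_ones,
    Nat.cast_sum, ← Finset.sum_fiberwise Finset.univ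
      (fun x => (⟦x⟧ : Quotient (Equiv.Perm.SameCycle.setoid σ)))]
  exact Finset.sum_le_sum fun q _ => by simpa using hfib q

/-- The number of orbits is bounded by the numbers of fixed points of the first powers. -/
theorem orbitCount_le [DecidableEq X] (σ : Equiv.Perm X) {M : ℕ} (hM : 0 < M) :
    (orbitCount σ : ℝ) ≤ Fintype.card X / M +
      ∑ j ∈ Finset.Icc 1 M, ((Finset.univ.filter fun x => (σ ^ j) x = x).card : ℝ) / j := by
  refine (orbitCount_le_sum σ).trans ?_
  have hpt : ∀ x : X, (1 : ℝ) / minimalPeriod σ x ≤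
      1 / M + ∑ j ∈ Finset.Icc 1 M, if (σ ^ j) x = x then (1 : ℝ) / j else 0 := by
    intro x
    have hpos := minimalPeriod_perm_pos σ x
    have hnn : ∀ j ∈ Finset.Icc 1 M, (0 : ℝ) ≤ if (σ ^ j) x = x then (1 : ℝ) / j else 0 :=
      fun j _ => by split_ifs <;> positivity
    -- A short period is itself one of the indices `j`; a long one is paid for by 1/M.
    rcases le_or_gt (minimalPeriod σ x) M with h | h
    · have hfix : (σ ^ minimalPeriod σ x) x = x := by
        rw [← iterate_eq_pow_apply]; exact iterate_minimalPeriod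
      have := Finset.single_le_sum hnn (Finset.mem_Icc.2 ⟨hpos, h⟩)
      rw [if_pos hfix] at this
      have h0 : (0 : ℝ) ≤ 1 / M := by positivity
      linarith
    · have h1 : (1 : ℝ) / minimalPeriod σ x ≤ 1 / M := by gcongr
      have := Finset.sum_nonneg hnn
      linarith
  refine (Finset.sum_le_sum fun x _ => hpt x).trans (le_of_eq ?_)
  rw [Finset.sum_add_distrib, Finset.sum_comm]
  congr 1
  · simp [div_eq_mul_inv]
  · refine Finset.sum_congr rfl fun j _ => ?_
    rw [← Finset.sum_filter, Finset.sum_const, nsmul_eq_mul, mul_one_div]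

/-- All points, listed orbit by orbit along the permutation. -/
theorem exists_list_orbits (σ : Equiv.Perm X) :
    ∃ (l : List X) (R : Finset X), l.Nodup ∧ (∀ x, x ∈ l) ∧ R.card ≤ orbitCount σ ∧
      l.IsChain fun u v => σ u = v ∨ σ u ∈ R := by
  classical
  let Q := Quotient (Equiv.Perm.SameCycle.setoid σ)
  let orb : Q → List X := fun q => (List.range (minimalPeriod σ q.out)).map fun i => σ^[i] q.out
  have hmem : ∀ (q : Q) (x : X), x ∈ orb q → (Quotient.mk _ x : Q) = q := by
    intro q x hx
    obtain ⟨i, hi, rfl⟩ := List.mem_map.1 hx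
    have hs : σ.SameCycle q.out (σ^[i] q.out) :=
      sameCycle_iff_exists_iterate.2 ⟨i, List.mem_range.1 hi, rfl⟩
    exact (Quotient.sound (s := Equiv.Perm.SameCycle.setoid σ) hs.symm).trans (Quotient.out_eq q)
  have hne : ∀ q : Q, orb q ≠ [] := fun q h => by
    have h0 : minimalPeriod σ q.out = 0 := by simpa [orb] using h
    exact (minimalPeriod_perm_pos σ q.out).ne' h0
  have hlast : ∀ (q : Q) (u : X), u ∈ (orb q).getLast? → σ u = q.out := by
    intro q u hu
    have hpos := minimalPeriod_perm_pos σ q.out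
    obtain ⟨k, hk⟩ := Nat.exists_eq_succ_of_ne_zero hpos.ne'
    simp only [orb, hk, Nat.succ_eq_add_one, List.range_succ, List.map_append, List.map_cons, List.map_nil,
      List.getLast?_append, List.getLast?_singleton] at hu
    have hu' : σ^[k] q.out = u := by simpa using hu
    rw [← hu', ← Function.iterate_succ_apply' σ, ← hk]
    exact iterate_minimalPeriod
  -- `R` consists of the orbit representatives: `σ` sends the last point of each block back to its
  -- first.
  refine ⟨((Finset.univ : Finset Q).toList.map orb).flatten,
    (Finset.univ : Finset Q).image Quotient.out, ?_, ?_, ?_, ?_⟩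
  · rw [List.nodup_flatten]
    refine ⟨?_, ?_⟩
    · intro l hl
      obtain ⟨q, -, rfl⟩ := List.mem_map.1 hl
      refine List.Nodup.map_on ?_ List.nodup_range
      intro i hi j hj h
      exact (iterate_eq_iterate_iff_of_lt_minimalPeriod (by simpa using hi) (by simpa using hj)).1 h
    · rw [List.pairwise_map]
      refine (Finset.nodup_toList _).imp fun {q q'} hqq => ?_
      intro x hx hx'
      exact hqq ((hmem q x hx).symm.trans (hmem q' x hx'))
  · intro x
    rw [List.mem_flatten]
    refine ⟨orb (Quotient.mk _ x), List.mem_map.2 ⟨_, by simp, rfl⟩, ?_⟩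
    have hs : σ.SameCycle (Quotient.mk (Equiv.Perm.SameCycle.setoid σ) x).out x :=
      Quotient.mk_out (s := Equiv.Perm.SameCycle.setoid σ) x
    obtain ⟨i, hi, he⟩ := sameCycle_iff_exists_iterate.1 hs
    exact List.mem_map.2 ⟨i, List.mem_range.2 hi, he⟩
  · refine Finset.card_image_le.trans ?_
    rw [orbitCount, Nat.card_eq_fintype_card, Finset.card_univ]
  · rw [List.isChain_flatten (by simpa using fun q => hne q)]
    refine ⟨?_, ?_⟩
    · intro l hl
      obtain ⟨q, -, rfl⟩ := List.mem_map.1 hl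
      rw [List.isChain_map, List.isChain_range]
      intro i _
      exact Or.inl (Function.iterate_succ_apply' σ i _).symm
    · rw [List.isChain_map]
      refine List.Pairwise.isChain (List.pairwise_of_forall fun q q' => ?_)
      intro u hu v _
      exact Or.inr (by
        rw [hlast q u hu]
        exact Finset.mem_image_of_mem _ (Finset.mem_univ _))

/-- Numbering the points along the list of orbits turns `σ` into i ↦ i + 1, except where `σ` maps
into `R` and possibly at the last index, whence the extra 1. -/
theorem exists_conj_hammingDist_le {n : ℕ} (σ : Equiv.Perm (Fin n)) :
    ∃ π : Equiv.Perm (Fin n),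
      hammingDist ⇑(π * σ * π⁻¹) ⇑(finRotate n) ≤ orbitCount σ + 1 := by
  obtain ⟨l, R, hnd, hall, hR, hch⟩ := exists_list_orbits σ
  have hlen : l.length = n := by
    rw [← List.toFinset_card_of_nodup hnd, (Finset.eq_univ_iff_forall.2 fun x => List.mem_toFinset.2 (hall x) : l.toFinset = Finset.univ),
      Finset.card_univ, Fintype.card_fin]
  let e : Fin n ≃ Fin n := (finCongr hlen.symm).trans (hnd.getEquivOfForallMemList l hall)
  have he : ∀ i : Fin n, e i = l[(i : ℕ)]'(by omega) := fun i => rfl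
  refine ⟨e⁻¹, ?_⟩
  rw [List.isChain_iff_getElem] at hch
  obtain _ | n := n
  · simp [hammingDist]
  calc _ ≤ ((R.image fun x => e⁻¹ (σ⁻¹ x)) ∪ {Fin.last n}).card := by
        refine Finset.card_le_card fun i hi => ?_
        rw [Finset.mem_union, Finset.mem_singleton]
        by_cases hlast : i = Fin.last n
        · exact Or.inr hlast
        left
        have hi := (Finset.mem_filter.1 hi).2
        have hlt : (i : ℕ) < n := by
          have := Fin.val_lt_last hlast
          simpa using this
        have hrot : finRotate (n + 1) i = ⟨i + 1, by omega⟩ := finRotate_of_lt hlt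
        rcases hch i (by omega) with h | h
        · refine absurd ?_ hi
          rw [hrot]
          change e.symm (σ (e i)) = _
          rw [Equiv.symm_apply_eq, he, he]
          exact h
        · refine Finset.mem_image.2 ⟨_, h, ?_⟩
          change e.symm (σ.symm (σ _)) = i
          rw [Equiv.symm_apply_apply, Equiv.symm_apply_eq, he]
    _ ≤ R.card + 1 := (Finset.card_union_le _ _).trans (by
        rw [Finset.card_singleton]; exact Nat.add_le_add_right Finset.card_image_le 1)
    _ ≤ _ := by gcongr

end Cycles

/-! ### Couplings of conjugation invariant distributions -/

section Coupling

variable {A B : Type*}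

theorem pmf_sum_toReal [Fintype A] (p : PMF A) : ∑ a, (p a).toReal = 1 := by
  rw [← ENNReal.toReal_sum fun a _ => p.apply_ne_top a, ← tsum_fintype (L := .unconditional A), p.tsum_coe,
    ENNReal.toReal_one]

theorem pmf_sum_bind [Fintype A] [Fintype B] (p : PMF A) (q : A → PMF B) (d : B → ℝ) :
    ∑ b, ((p.bind q) b).toReal * d b = ∑ a, (p a).toReal * ∑ b, (q a b).toReal * d b := by
  have h : ∀ b, ((p.bind q) b).toReal = ∑ a, (p a).toReal * (q a b).toReal := fun b => by
    rw [PMF.bind_apply, tsum_fintype,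
      ENNReal.toReal_sum fun a _ => ENNReal.mul_ne_top (p.apply_ne_top a) ((q a).apply_ne_top b)]
    simp only [ENNReal.toReal_mul]
  simp only [h, Finset.sum_mul, Finset.mul_sum]
  rw [Finset.sum_comm]
  simp only [mul_assoc]

open Classical in
theorem pmf_sum_pure [Fintype B] (b₀ : B) (d : B → ℝ) :
    ∑ b, ((PMF.pure b₀ : PMF B) b).toReal * d b = d b₀ := by
  rw [Finset.sum_eq_single b₀] <;> simp +contextual [PMF.pure_apply]

theorem pmf_sum_map [Fintype A] [Fintype B] (p : PMF A) (f : A → B) (d : B → ℝ) :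
    ∑ b, ((p.map f) b).toReal * d b = ∑ a, (p a).toReal * d (f a) := by
  rw [← PMF.bind_pure_comp, pmf_sum_bind]
  simp only [Function.comp_apply, pmf_sum_pure]

theorem pmf_uniform_map_equiv [Fintype A] [Nonempty A] [Fintype B] [Nonempty B] (e : A ≃ B) :
    (PMF.uniformOfFintype A).map e = PMF.uniformOfFintype B := by
  classical
  ext b
  rw [PMF.map_apply, tsum_fintype, Finset.sum_eq_single (e.symm b)]
  · simp [Fintype.card_congr e]
  · intro a _ ha
    rw [if_neg]
    rintro rfl
    simp at ha
  · simp

theorem krDist_le_transportCost {X : Type*} [Fintype X] {d : X → X → ℝ} (hd : ∀ x y, 0 ≤ d x y)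
    {μ ν : PMF X} {γ : PMF (X × X)} (hγ : IsCoupling μ ν γ) :
    krDist d μ ν ≤ transportCost d γ := by
  refine csInf_le ⟨0, ?_⟩ ⟨γ, hγ, rfl⟩
  rintro c ⟨γ', -, rfl⟩
  exact Finset.sum_nonneg fun p _ => mul_nonneg ENNReal.toReal_nonneg (hd _ _)

theorem isCoupling_prod {X : Type*} (μ ν : PMF X) :
    IsCoupling μ ν (μ.bind fun x => ν.map fun y => (x, y)) := by
  constructor
  · simp only [PMF.map_bind, PMF.map_comp]
    simp [Function.comp_def, PMF.map, PMF.bind_const]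
  · simp only [PMF.map_bind, PMF.map_comp]
    simp [Function.comp_def, PMF.map, PMF.bind_const]

theorem normHamming_nonneg {n : ℕ} (σ τ : Equiv.Perm (Fin n)) : 0 ≤ normHamming σ τ := by
  unfold normHamming; positivity

theorem krDist_normHamming_le_one {n : ℕ} (μ ν : PMF (Equiv.Perm (Fin n))) :
    krDist normHamming μ ν ≤ 1 := by
  refine (krDist_le_transportCost normHamming_nonneg (isCoupling_prod μ ν)).trans ?_
  rw [← pmf_sum_toReal (μ.bind fun x => ν.map fun y => (x, y))]
  refine Finset.sum_le_sum fun p _ => mul_le_of_le_one_right ENNReal.toReal_nonneg ?_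
  refine div_le_one_of_le₀ ?_ (Nat.cast_nonneg n)
  exact_mod_cast (hammingDist_le_card_fintype (x := ⇑p.1) (y := ⇑p.2)).trans (by simp)

theorem normHamming_conj {n : ℕ} (π σ τ : Equiv.Perm (Fin n)) :
    normHamming (π * σ * π⁻¹) (π * τ * π⁻¹) = normHamming σ τ := by
  unfold normHamming hammingDist
  congr 2
  refine Finset.card_bij' (fun i _ => π⁻¹ i) (fun i _ => π i) ?_ ?_ ?_ ?_ <;> simp

/-- A distribution on a group is conjugation invariant. -/
def IsConjInvariant {G : Type*} [Group G] (μ : PMF G) : Prop :=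
  ∀ π : G, μ.map (fun σ => π * σ * π⁻¹) = μ

/-- For fixed `σ`, the product `ρ * f σ` is as uniform as `ρ`, so the correction `f` disappears.
This gives the marginals of the coupling. -/
theorem bind_uniform_conj {G : Type*} [Group G] [Fintype G] {μ : PMF G} (hμ : IsConjInvariant μ)
    (f : G → G) :
    ((PMF.uniformOfFintype G).bind fun ρ => μ.map fun σ => ρ * f σ * σ * (ρ * f σ)⁻¹) = μ := by
  calc _ = μ.bind fun σ => (PMF.uniformOfFintype G).map fun ρ => ρ * f σ * σ * (ρ * f σ)⁻¹ := by
        simp only [← PMF.bind_pure_comp]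
        rw [PMF.bind_comm]
        rfl
    _ = μ.bind fun σ => (PMF.uniformOfFintype G).map fun ρ => ρ * σ * ρ⁻¹ := by
        congr 1
        funext σ
        conv_rhs => rw [← pmf_uniform_map_equiv (Equiv.mulRight (f σ)), PMF.map_comp]
        rfl
    _ = (PMF.uniformOfFintype G).bind fun ρ => μ.map fun σ => ρ * σ * ρ⁻¹ := by
        simp only [← PMF.bind_pure_comp]
        rw [PMF.bind_comm]
        rfl
    _ = μ := by
        have : (fun ρ : G => μ.map fun σ => ρ * σ * ρ⁻¹) = fun _ => μ := funext hμ
        rw [this, PMF.bind_const]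

/-- The word map commutes with simultaneous conjugation, which preserves the uniform measure on
tuples. -/
theorem isConjInvariant_wordDistribution {r : ℕ} (w : FreeGroup (Fin r)) (G : Type*) [Group G]
    [Fintype G] : IsConjInvariant (wordDistribution w G) := by
  intro π
  have h : (fun σ => π * σ * π⁻¹) ∘ wordMap w G =
      wordMap w G ∘ (Equiv.piCongrRight fun _ : Fin r => (MulAut.conj π).toEquiv) := by
    funext g
    have h2 : (MulAut.conj π).toMonoidHom.comp (FreeGroup.lift g) =
        FreeGroup.lift ((Equiv.piCongrRight fun _ : Fin r => (MulAut.conj π).toEquiv) g) := by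
      ext i
      simp
    exact DFunLike.congr_fun h2 w
  rw [wordDistribution, PMF.map_comp, h, ← PMF.map_comp, pmf_uniform_map_equiv]

/-- Lets the estimates for words also cover the uniform measure. -/
theorem wordDistribution_of (G : Type*) [Group G] [Fintype G] :
    wordDistribution (FreeGroup.of (0 : Fin 1)) G = PMF.uniformOfFintype G := by
  have h : wordMap (FreeGroup.of (0 : Fin 1)) G = Equiv.funUnique (Fin 1) G := by
    funext g
    simp [wordMap]
  rw [wordDistribution, h, pmf_uniform_map_equiv]

/-- Conjugation invariant distributions are close if permutations have few orbits on average. -/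
theorem krDist_le_orbitCount {n : ℕ} {μ ν : PMF (Equiv.Perm (Fin n))}
    (hμ : IsConjInvariant μ) (hν : IsConjInvariant ν) :
    krDist normHamming μ ν ≤ (∑ σ, (μ σ).toReal * (orbitCount σ : ℝ) +
      ∑ σ, (ν σ).toReal * (orbitCount σ : ℝ) + 2) / n := by
  choose f hf using fun σ : Equiv.Perm (Fin n) => exists_conj_hammingDist_le σ
  -- The common factor `ρ` leaves the distance unchanged and restores the marginals.
  let γ : PMF (Equiv.Perm (Fin n) × Equiv.Perm (Fin n)) :=
    (PMF.uniformOfFintype (Equiv.Perm (Fin n))).bind fun ρ => μ.bind fun σ => ν.map fun τ =>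
      (ρ * f σ * σ * (ρ * f σ)⁻¹, ρ * f τ * τ * (ρ * f τ)⁻¹)
  have hγ : IsCoupling μ ν γ := by
    constructor
    · conv_rhs => rw [← bind_uniform_conj hμ f]
      simp only [γ, PMF.map_bind, PMF.map_comp]
      congr 1
      funext ρ
      simp [Function.comp_def, PMF.map, PMF.bind_const]
    · conv_rhs => rw [← bind_uniform_conj hν f]
      simp only [γ, PMF.map_bind, PMF.map_comp]
      congr 1
      funext ρ
      simp [Function.comp_def, PMF.map, PMF.bind_const]
  have hd : ∀ ρ σ τ : Equiv.Perm (Fin n),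
      normHamming (ρ * f σ * σ * (ρ * f σ)⁻¹) (ρ * f τ * τ * (ρ * f τ)⁻¹) ≤
        ((orbitCount σ : ℝ) + orbitCount τ + 2) / n := by
    intro ρ σ τ
    have h : ∀ σ : Equiv.Perm (Fin n), ρ * f σ * σ * (ρ * f σ)⁻¹ =
        ρ * (f σ * σ * (f σ)⁻¹) * ρ⁻¹ := fun σ => by group
    rw [h, h, normHamming_conj, normHamming]
    gcongr
    have h1 := hammingDist_triangle_right ⇑(f σ * σ * (f σ)⁻¹) ⇑(f τ * τ * (f τ)⁻¹) ⇑(finRotate n)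
    have h2 := hf σ
    have h3 := hf τ
    exact_mod_cast (by omega : hammingDist ⇑(f σ * σ * (f σ)⁻¹) ⇑(f τ * τ * (f τ)⁻¹) ≤
      orbitCount σ + orbitCount τ + 2)
  refine (krDist_le_transportCost normHamming_nonneg hγ).trans ?_
  rw [transportCost, pmf_sum_bind]
  simp only [pmf_sum_bind, pmf_sum_map]
  calc _ ≤ ∑ ρ, ((PMF.uniformOfFintype (Equiv.Perm (Fin n))) ρ).toReal *
        ∑ σ, (μ σ).toReal * ∑ τ, (ν τ).toReal * (((orbitCount σ : ℝ) + orbitCount τ + 2) / n) := by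
        gcongr
        exact hd _ _ _
    _ = _ := by
        rw [← Finset.sum_mul, pmf_sum_toReal, one_mul]
        simp only [mul_div_assoc', ← Finset.sum_div, mul_add, Finset.sum_add_distrib,
          ← Finset.sum_mul, pmf_sum_toReal, one_mul]

end Coupling

/-! ### The expected number of orbits of a word value -/

theorem freeGroup_norm_pow_le {α : Type*} [DecidableEq α] (w : FreeGroup α) (j : ℕ) :
    (w ^ j).norm ≤ j * w.norm := by
  induction j with
  | zero => simp
  | succ j ih =>
    rw [pow_succ, add_mul, one_mul]
    exact (FreeGroup.norm_mul_le _ _).trans (Nat.add_le_add_right ih _)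

/-- The average number of fixed points of a non-trivial word of length at most `m`. -/
theorem sum_card_fixedPoints_le {α X : Type*} [Fintype α] [DecidableEq α] [Fintype X]
    [DecidableEq X] {w : FreeGroup α} (hw : w ≠ 1) {m : ℕ} (hm : w.norm ≤ m)
    (hmX : 2 * m ≤ Fintype.card X) :
    ∑ g : α → Equiv.Perm X, ((Finset.univ.filter fun x => FreeGroup.lift g w x = x).card : ℝ) ≤
      2 * (m : ℝ) ^ 2 * Fintype.card (α → Equiv.Perm X) := by
  have hswap : ∑ g : α → Equiv.Perm X,
      ((Finset.univ.filter fun x => FreeGroup.lift g w x = x).card : ℝ) =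
      ∑ x : X, ((Finset.univ.filter fun g : α → Equiv.Perm X =>
        FreeGroup.lift g w x = x).card : ℝ) := by
    simp only [Finset.card_filter, Nat.cast_sum]
    exact Finset.sum_comm
  have hpt : ∀ x : X, ((Finset.univ.filter fun g : α → Equiv.Perm X =>
      FreeGroup.lift g w x = x).card : ℝ) * Fintype.card X ≤
        2 * (m : ℝ) ^ 2 * Fintype.card (α → Equiv.Perm X) := by
    intro x
    have h := card_fixing_mul_le hw x hm
    have h2 : Fintype.card X ≤ 2 * (Fintype.card X - m) := by omega
    have h3 := (Nat.mul_le_mul_left (Finset.univ.filter fun g : α → Equiv.Perm X =>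
      FreeGroup.lift g w x = x).card h2).trans
      ((by ring : _ = 2 * _).trans_le (Nat.mul_le_mul_left 2 h))
    calc _ ≤ ((2 * (m * m * Fintype.card (α → Equiv.Perm X)) : ℕ) : ℝ) := by exact_mod_cast h3
      _ = _ := by push_cast; ring
  rw [hswap]
  rcases isEmpty_or_nonempty X with hX | hX
  · simp
  have hpos : (0 : ℝ) < Fintype.card X := by exact_mod_cast Fintype.card_pos
  have h := Finset.sum_le_sum fun x (_ : x ∈ (Finset.univ : Finset X)) => hpt x
  rw [← Finset.sum_mul, Finset.sum_const, Finset.card_univ, nsmul_eq_mul, mul_comm] at h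
  exact le_of_mul_le_mul_left h hpos

theorem sum_wordDistribution_orbitCount_le {r n : ℕ} {w : FreeGroup (Fin r)} (hw : w ≠ 1) {M : ℕ}
    (hM : 0 < M) (hMn : 2 * (M * w.norm) ≤ n) :
    ∑ σ, (wordDistribution w (Equiv.Perm (Fin n)) σ).toReal * (orbitCount σ : ℝ) ≤
      n / M + 2 * (w.norm : ℝ) ^ 2 * M ^ 2 := by
  set N : ℝ := (Fintype.card (Fin r → Equiv.Perm (Fin n)) : ℝ) with hN
  have hNpos : 0 < N := by rw [hN]; exact_mod_cast Fintype.card_pos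
  have hfix : ∀ j ∈ Finset.Icc 1 M, (∑ g : Fin r → Equiv.Perm (Fin n),
      ((Finset.univ.filter fun x => (wordMap w _ g ^ j) x = x).card : ℝ) / j) ≤
        2 * (w.norm : ℝ) ^ 2 * M * N := by
    intro j hj
    obtain ⟨hj1, hjM⟩ := Finset.mem_Icc.1 hj
    -- Free groups are torsion-free.
    have hwj : w ^ j ≠ 1 := fun h => hw (by simpa [show j ≠ 0 by omega] using h)
    have h := sum_card_fixedPoints_le (X := Fin n) hwj (freeGroup_norm_pow_le w j) (by
      rw [Fintype.card_fin]
      exact (Nat.mul_le_mul_left 2 (Nat.mul_le_mul_right _ hjM)).trans hMn)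
    simp only [map_pow] at h
    have hj0 : (0 : ℝ) < j := by exact_mod_cast hj1
    rw [← Finset.sum_div, div_le_iff₀ hj0]
    refine h.trans ?_
    rw [← hN]
    push_cast
    have hjM' : (j : ℝ) ≤ M := by exact_mod_cast hjM
    calc 2 * ((j : ℝ) * w.norm) ^ 2 * N = (2 * (w.norm : ℝ) ^ 2 * N * j) * j := by ring
      _ ≤ (2 * (w.norm : ℝ) ^ 2 * N * j) * M := by gcongr
      _ = _ := by ring
  have hunif : ∀ g, ((PMF.uniformOfFintype (Fin r → Equiv.Perm (Fin n))) g).toReal = N⁻¹ := by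
    intro g
    simp [hN, ENNReal.toReal_inv]
  rw [wordDistribution, pmf_sum_map]
  simp only [hunif]
  rw [← Finset.mul_sum, inv_mul_le_iff₀ hNpos]
  calc _ ≤ ∑ g : Fin r → Equiv.Perm (Fin n), ((n : ℝ) / M + ∑ j ∈ Finset.Icc 1 M,
        ((Finset.univ.filter fun x => (wordMap w _ g ^ j) x = x).card : ℝ) / j) := by
        refine Finset.sum_le_sum fun g _ => ?_
        simpa using orbitCount_le (wordMap w _ g) hM
    _ = N * (n / M) + ∑ j ∈ Finset.Icc 1 M, ∑ g : Fin r → Equiv.Perm (Fin n),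
        ((Finset.univ.filter fun x => (wordMap w _ g ^ j) x = x).card : ℝ) / j := by
        rw [Finset.sum_add_distrib, Finset.sum_comm (s := Finset.univ), Finset.sum_const,
          Finset.card_univ, nsmul_eq_mul]
    _ ≤ N * (n / M) + ∑ j ∈ Finset.Icc 1 M, 2 * (w.norm : ℝ) ^ 2 * M * N := by
        gcongr with j hj
        exact hfix j hj
    _ = _ := by
        rw [Finset.sum_const, Nat.card_Icc, nsmul_eq_mul, Nat.add_sub_cancel]
        ring

/-- The choice M = ⌈n^(1/3)⌉ makes n/M and M² both of order n^(2/3). When `M` is too large for the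
fixed-point bound, the trivial bound 1 suffices. -/
theorem krDist_wordDistribution_le {r n : ℕ} {w : FreeGroup (Fin r)} (hw : w ≠ 1) (hn : 1 ≤ n) :
    krDist normHamming (wordDistribution w (Equiv.Perm (Fin n)))
      (PMF.uniformOfFintype (Equiv.Perm (Fin n))) ≤
        20 * (w.norm : ℝ) ^ 2 * (n : ℝ) ^ (-(1 / 3 : ℝ)) := by
  have hl1 : 1 ≤ w.norm := Nat.one_le_iff_ne_zero.2 fun h => hw (FreeGroup.norm_eq_zero.1 h)
  have hn1 : (1 : ℝ) ≤ n := by exact_mod_cast hn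
  set l : ℝ := (w.norm : ℝ) with hl
  have hl1' : 1 ≤ l := by rw [hl]; exact_mod_cast hl1
  set t : ℝ := (n : ℝ) ^ (1 / 3 : ℝ) with ht
  have ht1 : 1 ≤ t := Real.one_le_rpow hn1 (by norm_num)
  have ht3 : t ^ 3 = n := by
    rw [ht, ← Real.rpow_natCast, ← Real.rpow_mul (by linarith)]
    norm_num
  have hti : (n : ℝ) ^ (-(1 / 3 : ℝ)) = t⁻¹ := Real.rpow_neg (by linarith) _
  rw [hti]
  set M := ⌈t⌉₊ with hM
  have hM0 : 0 < M := Nat.ceil_pos.2 (by linarith)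
  have hMt : t ≤ M := Nat.le_ceil t
  have hM2 : (M : ℝ) ≤ 2 * t := by
    have := Nat.ceil_lt_add_one (show 0 ≤ t by linarith)
    linarith
  by_cases hcase : 2 * (M * w.norm) ≤ n
  · have h1 := sum_wordDistribution_orbitCount_le hw hM0 hcase
    have h2 := sum_wordDistribution_orbitCount_le (n := n)
      (FreeGroup.of_ne_one (0 : Fin 1)) hM0 (by
        rw [FreeGroup.norm_of]
        exact (Nat.mul_le_mul_left 2 (Nat.mul_le_mul_left M hl1)).trans hcase)
    have h3 := krDist_le_orbitCount (isConjInvariant_wordDistribution w (Equiv.Perm (Fin n)))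
      (isConjInvariant_wordDistribution (FreeGroup.of (0 : Fin 1)) (Equiv.Perm (Fin n)))
    rw [wordDistribution_of] at h2 h3
    rw [FreeGroup.norm_of] at h2
    have hnM : (n : ℝ) / M ≤ t ^ 2 := by
      rw [div_le_iff₀ (by linarith), ← ht3]
      calc t ^ 3 = t ^ 2 * t := by ring
        _ ≤ t ^ 2 * M := by gcongr
    have hMM : (M : ℝ) ^ 2 ≤ 4 * t ^ 2 := by
      calc (M : ℝ) ^ 2 ≤ (2 * t) ^ 2 := by gcongr
        _ = _ := by ring
    have hl2 : 1 ≤ l ^ 2 := one_le_pow₀ hl1'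
    have ht2 : 1 ≤ t ^ 2 := one_le_pow₀ ht1
    refine h3.trans ?_
    rw [div_le_iff₀ (by linarith)]
    have e : 20 * l ^ 2 * t⁻¹ * n = 20 * l ^ 2 * t ^ 2 := by
      rw [← ht3]; field_simp
    rw [e]
    have h4 : 2 * l ^ 2 * (M : ℝ) ^ 2 ≤ 2 * l ^ 2 * (4 * t ^ 2) := by gcongr
    have h5 : 1 * t ^ 2 ≤ l ^ 2 * t ^ 2 := by gcongr
    simp only [Nat.cast_one, one_pow, mul_one] at h2
    rw [← hl] at h1
    rw [one_mul] at h5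
    -- The word contributes t² + 8l²t², the uniform measure t² + 8t², and 2 ≤ 2t²; together at most
    -- 20l²t².
    linarith
  · refine (krDist_normHamming_le_one _ _).trans ?_
    have h1 : (n : ℝ) < 2 * (M * l) := by
      rw [hl]; exact_mod_cast not_le.1 hcase
    have h2 : t ^ 3 < 4 * t * l := by
      rw [ht3]
      calc (n : ℝ) < 2 * (M * l) := h1
        _ ≤ 2 * (2 * t * l) := by gcongr
        _ = _ := by ring
    have h3 : t ^ 2 < 4 * l := by
      refine lt_of_mul_lt_mul_left (a := t) ?_ (by linarith)
      linarith [h2, (by ring : t * t ^ 2 = t ^ 3), (by ring : t * (4 * l) = 4 * t * l)]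
    rw [← div_eq_mul_inv, one_le_div (by linarith)]
    have h4 : t ≤ t ^ 2 := le_self_pow₀ ht1 two_ne_zero
    have h5 : l ≤ l ^ 2 := le_self_pow₀ hl1' two_ne_zero
    linarith

theorem corollary1p5 (ε : ℝ) (hε : 0 < ε) :
    ∃ c : ℝ, 0 < c ∧
      ∀ (r : ℕ) (w : FreeGroup (Fin r)), w ≠ 1 →
        ∀ n : ℕ, 1 ≤ n →
          krDist normHamming (wordDistribution w (Equiv.Perm (Fin n)))
              (PMF.uniformOfFintype (Equiv.Perm (Fin n)))
            ≤ c * (w.norm : ℝ) ^ 2 * (n : ℝ) ^ (-(1 / 3 : ℝ) + ε) := by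
  -- As n ≥ 1, adding ε to the exponent only weakens the bound.
  refine ⟨20, by norm_num, fun r w hw n hn => (krDist_wordDistribution_le hw hn).trans ?_⟩
  gcongr
  · exact_mod_cast hn
  · linarith
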